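/- Let $T>0$ and let $\gamma:\mathbb{R}\to\mathbb{R}$ be a $T$-periodic function of class $C^1$. Write $\overline{\gamma}=\frac1T\int_0^T\gamma(t)\,dt$ and $\widehat\gamma=\gamma-\overline\gamma$. Let $C^1_T$ be the space of $T$-periodic $C^1$ functions $\mathbb{R}\to\mathbb{R}$ and $C^1_{T,0}$ its subspace of functions with zero average. Define \[ \underline{\mu}[\gamma](p)=-\max_{t\in[0,T]}\bigl\{p(t)^2+\widehat\gamma(t)-p'(t)\bigr\}\quad(p\in C^1_T), \] \[ \overline{\mu}[\gamma](q)=\Bigl(\int_0^T e^{-2\int_0^t q(s)\,ds}\,dt\Bigr)^{-1}\int_0^T e^{-2\int_0^t q(s)\,ds}\bigl(q(t)^2-\widehat\gamma(t)\bigr)\,dt\quad(q\in C^1_{T,0}). \] A limit cycle of $x'=x^2+\gamma(t)$ is an isolated $T$-periodic solution $\phi$, that is, a $T$-periodic solution such that no other $T$-periodic solution has an initial value at $t=0$ close to $\phi(0)$. Let $d(x_0)=x(T;x_0)-x_0$ be the displacement map, where $x(\cdot\,;x_0)$ is the solution with $x(0;x_0)=x_0$. A limit cycle $\phi$ is hyperbolic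 if $\phi(0)$ is a simple zero of $d$, and double if $\phi(0)$ is a zero of $d$ of multiplicity two. It is semi-stable if the nearby solutions on one side of $\phi$ are asymptotic to $\phi$ as $t\to+\infty$ and those on the other side are asymptotic to $\phi$ as $t\to-\infty$. Then the maximum of $\underline\mu[\gamma]$ over $C^1_T$ and the minimum of $\overline\mu[\gamma]$ over $C^1_{T,0}$ exist and coincide. Let $\gamma^*$ be their common value and $\Delta_\gamma=\gamma^*-\overline\gamma$. The differential equation \[ x'=x^2+\gamma(t) \] has exactly two limit cycles, both hyperbolic, if $\Delta_\gamma>0$; it has a unique limit cycle, which is semi-stable and double, if $\Delta_\gamma=0$; and it has no limit cycles if $\Delta_\gamma<0$. Moreover, \[ \underline{\mu}[\gamma](p)-\overline\gamma\le\Delta_\gamma\le\overline{\mu}[\gamma](q)-\overline\gamma \] for every $p\in C^1_T$ and every $q\in C^1_{T,0}$. -/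

import Mathlib

namespace RiccatiEq

noncomputable section

/-! ### Scalar `T`-periodic differential equations `x' = f(t, x)` -/

/-- `x` solves `x' = f(t, x)` on the set of times `s` (one-sided derivatives at end points). -/
def IsSolutionOn (f : ℝ → ℝ → ℝ) (x : ℝ → ℝ) (s : Set ℝ) : Prop :=
  ∀ t ∈ s, HasDerivWithinAt x (f t (x t)) s t

/-- `φ` is a `T`-periodic solution of `x' = f(t, x)`, defined for all times. -/
def IsPeriodicSolution (f : ℝ → ℝ → ℝ) (T : ℝ) (φ : ℝ → ℝ) : Prop :=
  Function.Periodic φ T ∧ IsSolutionOn f φ Set.univ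

/-- A limit cycle is an isolated periodic solution: no other periodic solution
has an initial value close to that of `φ`. -/
def IsLimitCycle (f : ℝ → ℝ → ℝ) (T : ℝ) (φ : ℝ → ℝ) : Prop :=
  IsPeriodicSolution f T φ ∧
    ∃ ε > 0, ∀ ψ, IsPeriodicSolution f T ψ → |ψ 0 - φ 0| < ε → ψ = φ

open Classical in
/-- The Poincaré map `x₀ ↦ x(T; x₀)`, where `x(·; x₀)` is the solution with `x(0; x₀) = x₀`.
It is meaningful for those `x₀` whose solution is defined on `[0, T]`; elsewhere the value is `0`. -/
def poincareMap (f : ℝ → ℝ → ℝ) (T : ℝ) (x₀ : ℝ) : ℝ :=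
  if h : ∃ x : ℝ → ℝ, x 0 = x₀ ∧ IsSolutionOn f x (Set.Icc 0 T) then h.choose T else 0

/-- The displacement map: the Poincaré map at time `T` minus the identity. -/
def displacement (f : ℝ → ℝ → ℝ) (T : ℝ) (x₀ : ℝ) : ℝ :=
  poincareMap f T x₀ - x₀

/-- `x₀` is a zero of multiplicity exactly `n` of `d`. -/
def IsZeroOfMultiplicity (d : ℝ → ℝ) (n : ℕ) (x₀ : ℝ) : Prop :=
  ContDiffAt ℝ n d x₀ ∧ (∀ k < n, iteratedDeriv k d x₀ = 0) ∧ iteratedDeriv n d x₀ ≠ 0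

/-- A limit cycle of multiplicity `n`. -/
def HasMultiplicity (f : ℝ → ℝ → ℝ) (T : ℝ) (φ : ℝ → ℝ) (n : ℕ) : Prop :=
  IsZeroOfMultiplicity (displacement f T) n (φ 0)

/-- `φ` is hyperbolic: the corresponding zero of the displacement map is simple. -/
def IsHyperbolic (f : ℝ → ℝ → ℝ) (T : ℝ) (φ : ℝ → ℝ) : Prop :=
  HasMultiplicity f T φ 1

/-- `φ` is double: the corresponding zero of the displacement map has multiplicity two. -/
def IsDouble (f : ℝ → ℝ → ℝ) (T : ℝ) (φ : ℝ → ℝ) : Prop :=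
  HasMultiplicity f T φ 2

/-- The solution starting at time `0` from `x₀` is asymptotic to `φ` as `t → +∞`. -/
def ForwardAsymptotic (f : ℝ → ℝ → ℝ) (φ : ℝ → ℝ) (x₀ : ℝ) : Prop :=
  ∃ x : ℝ → ℝ, x 0 = x₀ ∧ IsSolutionOn f x (Set.Ici 0) ∧
    Filter.Tendsto (fun t => x t - φ t) Filter.atTop (nhds 0)

/-- The solution starting at time `0` from `x₀` is asymptotic to `φ` as `t → -∞`. -/
def BackwardAsymptotic (f : ℝ → ℝ → ℝ) (φ : ℝ → ℝ) (x₀ : ℝ) : Prop :=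
  ∃ x : ℝ → ℝ, x 0 = x₀ ∧ IsSolutionOn f x (Set.Iic 0) ∧
    Filter.Tendsto (fun t => x t - φ t) Filter.atBot (nhds 0)

/-- `φ` is semi-stable: the nearby solutions on one side of `φ` are attracted by it (they approach
it as `t → +∞`) and those on the other side are repelled (they approach it as `t → -∞`). -/
def IsSemistable (f : ℝ → ℝ → ℝ) (φ : ℝ → ℝ) : Prop :=
  ∃ δ > 0,
    ((∀ x₀ ∈ Set.Ioo (φ 0 - δ) (φ 0), ForwardAsymptotic f φ x₀) ∧
      (∀ x₀ ∈ Set.Ioo (φ 0) (φ 0 + δ), BackwardAsymptotic f φ x₀)) ∨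
    ((∀ x₀ ∈ Set.Ioo (φ 0 - δ) (φ 0), BackwardAsymptotic f φ x₀) ∧
      (∀ x₀ ∈ Set.Ioo (φ 0) (φ 0 + δ), ForwardAsymptotic f φ x₀))

/-! ### The Riccati equation and its discriminant -/

/-- The right-hand side of `x' = x² + γ(t)`. -/
def riccati (γ : ℝ → ℝ) (t x : ℝ) : ℝ := x ^ 2 + γ t

/-- The average over a period. -/
def mean (T : ℝ) (γ : ℝ → ℝ) : ℝ := 1 / T * ∫ t in (0 : ℝ)..T, γ t

/-- The mean-centered function. -/
def centered (T : ℝ) (γ : ℝ → ℝ) (t : ℝ) : ℝ := γ t - mean T γ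

/-- The space of `T`-periodic `C¹` real functions. -/
def C1T (T : ℝ) : Set (ℝ → ℝ) := {p | ContDiff ℝ 1 p ∧ Function.Periodic p T}

/-- The space of `T`-periodic `C¹` real functions with zero average. -/
def C1T0 (T : ℝ) : Set (ℝ → ℝ) := {p | p ∈ C1T T ∧ mean T p = 0}

/-- The functional `p ↦ -max_{t ∈ [0,T]} (p(t)² + γ̂(t) - p'(t))`. -/
def muLower (T : ℝ) (γ p : ℝ → ℝ) : ℝ :=
  -sSup ((fun t => p t ^ 2 + centered T γ t - deriv p t) '' Set.Icc 0 T)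

/-- The weight `exp(-2 ∫₀ᵗ p)`. -/
def weight (p : ℝ → ℝ) (t : ℝ) : ℝ := Real.exp (-2 * ∫ s in (0 : ℝ)..t, p s)

/-- The weighted average of `p² - γ̂` with respect to the weight `exp(-2 ∫₀ᵗ p)`. -/
def muUpper (T : ℝ) (γ p : ℝ → ℝ) : ℝ :=
  (∫ t in (0 : ℝ)..T, weight p t)⁻¹ *
    ∫ t in (0 : ℝ)..T, weight p t * (p t ^ 2 - centered T γ t)

/-- The number `γ*`, the maximum of `muLower T γ` over all `T`-periodic `C¹` functions. -/
def gammaStar (T : ℝ) (γ : ℝ → ℝ) : ℝ := sSup (muLower T γ '' C1T T)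

/-- The discriminant `Δ_γ = γ* - mean γ`. -/
def discriminant (T : ℝ) (γ : ℝ → ℝ) : ℝ := gammaStar T γ - mean T γ

end

end RiccatiEq

namespace RiccatiEq

open Set Filter Topology

/-! ### Periodic solutions: regularity, extension and a priori bounds -/

/-! Put `γ = g + c` with `g` centered and `c` the mean, and let `c` vary. A value `muLower T γ p >
c` says that `p` is a strict upper solution, `p' > p² + g + c`, and this forces a periodic solution
to exist (`exists_isPeriodicSolution_of_upper`). The set of `c` admitting a periodic solution is
bounded above and contains its supremum. A periodic solution `φ` at the supremum has zero average,
since otherwise the linearized periodic problem is solvable and `c` could be raised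
(`exists_principal`). This `φ` is extremal for both functionals. `muLower_le` compares `p` with `φ`,
and `muUpper_eq` gives `muUpper T γ q` as the critical `c` plus a weighted mean of `(φ - q)²`.

Cycles are counted through the Riccati substitution. If `ψ` is a periodic solution, `1 / (x - ψ)`
satisfies a linear equation, so the period map is the Möbius map `v ↦ v / (W (1 - v B))` in `v = x 0
- ψ 0`, with `W = weight ψ T` and `B = invWeightPrimitive ψ T > 0`. Its fixed points are `v = 0` and
the root of `W (1 - v B) = 1`. They merge exactly when `W = 1`, that is, when `ψ` has zero average.
-/

theorem IsSolutionOn.hasDerivAt {f : ℝ → ℝ → ℝ} {x : ℝ → ℝ} (h : IsSolutionOn f x univ) (t : ℝ) :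
    HasDerivAt x (f t (x t)) t :=
  (h t (mem_univ t)).hasDerivAt univ_mem

theorem IsSolutionOn.mono {f : ℝ → ℝ → ℝ} {x : ℝ → ℝ} {s u : Set ℝ} (h : IsSolutionOn f x s)
    (hus : u ⊆ s) : IsSolutionOn f x u :=
  fun t ht => (h t (hus ht)).mono hus

theorem IsSolutionOn.continuousOn {f : ℝ → ℝ → ℝ} {x : ℝ → ℝ} {s : Set ℝ}
    (h : IsSolutionOn f x s) : ContinuousOn x s :=
  fun t ht => (h t ht).continuousWithinAt

theorem IsSolutionOn.continuous {f : ℝ → ℝ → ℝ} {x : ℝ → ℝ} (h : IsSolutionOn f x univ) :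
    Continuous x :=
  continuous_iff_continuousAt.2 fun t => (h.hasDerivAt t).continuousAt

theorem IsSolutionOn.hasDerivWithinAt_Ici {f : ℝ → ℝ → ℝ} {x : ℝ → ℝ} {a b : ℝ}
    (h : IsSolutionOn f x (Icc a b)) {t : ℝ} (ht : t ∈ Ico a b) :
    HasDerivWithinAt x (f t (x t)) (Ici t) t :=
  (h t (Ico_subset_Icc_self ht)).mono_of_mem_nhdsWithin (Icc_mem_nhdsGE_of_mem ht)

/-- A solution on one period with equal end values extends to a periodic solution. -/
theorem exists_isPeriodicSolution_of_eq {f : ℝ → ℝ → ℝ} {T : ℝ} (hT : 0 < T)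
    (hf : Continuous (Function.uncurry f)) (hper : ∀ t x, f (t + T) x = f t x) {x : ℝ → ℝ}
    (hx : IsSolutionOn f x (Icc 0 T)) (hxT : x T = x 0) :
    ∃ φ, IsPeriodicSolution f T φ ∧ φ 0 = x 0 := by
  have : Fact (0 < T) := ⟨hT⟩
  have hc : ContinuousOn (fun t => f t (x t)) (Icc 0 T) :=
    hf.comp_continuousOn (continuousOn_id.prodMk hx.continuousOn)
  have h0 : f 0 (x 0) = f T (x T) := by rw [hxT, ← hper 0, zero_add]
  -- The derivative is extended periodically and then integrated. Gluing translates of `x` would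
  -- require matching one-sided derivatives at the multiples of `T`.
  let g : ℝ → ℝ := fun t => AddCircle.liftIco T 0 (fun t => f t (x t)) (t : AddCircle T)
  have hg : Continuous g :=
    (AddCircle.liftIco_zero_continuous h0 hc).comp (AddCircle.continuous_mk' T)
  have hgper : Function.Periodic g T := fun t => by simp [g]
  have hgeq : ∀ t ∈ Ico 0 T, g t = f t (x t) := fun t ht =>
    AddCircle.liftIco_zero_coe_apply ht
  have hint : ∀ t ∈ Icc 0 T, x 0 + ∫ s in (0 : ℝ)..t, g s = x t := by
    intro t ht
    have hsub : Icc 0 t ⊆ Icc 0 T := Icc_subset_Icc_right ht.2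
    have := intervalIntegral.integral_eq_sub_of_hasDerivAt_of_le (f := x) (f' := g) ht.1
      (hx.continuousOn.mono hsub)
      (fun s hs => by
        have hs' : s ∈ Ioo 0 T := ⟨hs.1, hs.2.trans_le ht.2⟩
        rw [hgeq s (Ioo_subset_Ico_self hs')]
        exact (hx s (Ioo_subset_Icc_self hs')).hasDerivAt (Icc_mem_nhds hs'.1 hs'.2))
      (hg.intervalIntegrable _ _)
    rw [this]; ring
  have hgT : ∫ s in (0 : ℝ)..T, g s = 0 := by
    have := hint T ⟨hT.le, le_rfl⟩
    linarith
  let φ : ℝ → ℝ := fun t => x 0 + ∫ s in (0 : ℝ)..t, g s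
  have hφper : Function.Periodic φ T := by
    intro t
    have h1 := hgper.intervalIntegral_add_eq t 0
    rw [zero_add, hgT] at h1
    have h2 := intervalIntegral.integral_add_adjacent_intervals
      (hg.intervalIntegrable (μ := MeasureTheory.volume) 0 t) (hg.intervalIntegrable t (t + T))
    simp only [φ]
    rw [← h2, h1, add_zero]
  have hφd : ∀ t, HasDerivAt φ (g t) t := fun t =>
    (hg.integral_hasStrictDerivAt 0 t).hasDerivAt.const_add _
  have hkey : ∀ t, g t = f t (φ t) := by
    have hp : Function.Periodic (fun t => g t - f t (φ t)) T := by
      intro t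
      simp only [hgper t, hφper t, hper]
    intro t
    obtain ⟨s, hs, hst⟩ := hp.exists_mem_Ico₀ hT t
    have : φ s = x s := hint s (Ico_subset_Icc_self hs)
    rw [this, hgeq s hs, sub_self] at hst
    linarith
  refine ⟨φ, ⟨hφper, fun t _ => ?_⟩, by simp [φ]⟩
  rw [← hkey]
  exact (hφd t).hasDerivWithinAt

theorem continuous_riccati {γ : ℝ → ℝ} (hγ : Continuous γ) :
    Continuous (Function.uncurry (riccati γ)) := by
  unfold riccati Function.uncurry
  fun_prop

theorem riccati_add_period {γ : ℝ → ℝ} {T : ℝ} (hγ : Function.Periodic γ T) (t x : ℝ) :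
    riccati γ (t + T) x = riccati γ t x := by
  simp [riccati, hγ t]

theorem IsPeriodicSolution.mem_C1T {γ φ : ℝ → ℝ} {T : ℝ} (hγ : Continuous γ)
    (h : IsPeriodicSolution (riccati γ) T φ) : φ ∈ C1T T := by
  refine ⟨contDiff_one_iff_deriv.2 ⟨fun t => (h.2.hasDerivAt t).differentiableAt, ?_⟩, h.1⟩
  have : deriv φ = fun t => riccati γ t (φ t) := funext fun t => (h.2.hasDerivAt t).deriv
  rw [this]
  exact (continuous_riccati hγ).comp (continuous_id.prodMk h.2.continuous)

/-- At a maximum of `x²` one has `x x' = 0`, so either `x = 0` or `x² = -h ≤ K²`. -/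
theorem IsPeriodicSolution.abs_le {h x : ℝ → ℝ} {T K : ℝ} (hT : 0 < T) (hK : 0 ≤ K)
    (hh : ∀ t, |h t| ≤ K ^ 2) (hx : IsPeriodicSolution (riccati h) T x) (t : ℝ) : |x t| ≤ K := by
  have hc : Continuous fun t => x t ^ 2 := hx.2.continuous.pow 2
  obtain ⟨s, -, hs⟩ := isCompact_Icc.exists_isMaxOn (nonempty_Icc.2 hT.le) hc.continuousOn
  have hp : Function.Periodic (fun t => x t ^ 2) T := fun t => by simp only [hx.1 t]
  have hmax : ∀ r, x r ^ 2 ≤ x s ^ 2 := by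
    intro r
    obtain ⟨u, hu, hru⟩ := hp.exists_mem_Ico₀ hT r
    exact hru.le.trans (hs (Ico_subset_Icc_self hu))
  have hd := (hx.2.hasDerivAt s).pow 2
  have hz := (IsLocalMax.hasDerivAt_eq_zero (f := fun t => x t ^ 2)
    (Eventually.of_forall hmax) hd)
  have hsK : x s ^ 2 ≤ K ^ 2 := by
    have hz' : x s * (x s ^ 2 + h s) = 0 := by
      simp [riccati] at hz
      rcases hz with hz | hz <;> simp [hz]
    rcases mul_eq_zero.1 hz' with h1 | h1
    · simpa [h1] using sq_nonneg K
    · have := neg_abs_le (h s)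
      linarith [hh s]
  exact abs_le_of_sq_le_sq ((hmax t).trans hsK) hK

/-! ### The truncated equation -/

/-- The right-hand side `x² + g(t)` with the quadratic term truncated at `|x| = K`. -/
noncomputable def truncRiccati (K : ℝ) (g : ℝ → ℝ) (t x : ℝ) : ℝ :=
  (max (-K) (min K x)) ^ 2 + g t

theorem truncRiccati_of_abs_le {K x : ℝ} (hx : |x| ≤ K) (g : ℝ → ℝ) (t : ℝ) :
    truncRiccati K g t x = riccati g t x := by
  have := _root_.abs_le.1 hx
  rw [truncRiccati, riccati, min_eq_right this.2, max_eq_right this.1]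

theorem abs_trunc_le {K : ℝ} (hK : 0 ≤ K) (x : ℝ) : |max (-K) (min K x)| ≤ K :=
  abs_le'.2 ⟨max_le (by linarith) (min_le_left _ _), by
    have := le_max_left (-K) (min K x)
    linarith⟩

theorem lipschitzWith_truncRiccati (K : NNReal) (g : ℝ → ℝ) (t : ℝ) :
    LipschitzWith (2 * K) (truncRiccati K g t) := by
  refine LipschitzWith.of_dist_le_mul fun x y => ?_
  have hx := abs_trunc_le K.2 x
  have hy := abs_trunc_le K.2 y
  have hxy : |max (-(K : ℝ)) (min K x) - max (-(K : ℝ)) (min K y)| ≤ |x - y| :=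
    (abs_max_sub_max_le_max _ _ _ _).trans (by
      rw [sub_self, abs_zero]
      refine max_le (abs_nonneg _) ((abs_min_sub_min_le_max _ _ _ _).trans ?_)
      simp)
  simp only [truncRiccati, Real.dist_eq, NNReal.coe_mul, NNReal.coe_ofNat, add_sub_add_right_eq_sub]
  rw [sq_sub_sq, abs_mul]
  refine mul_le_mul ((abs_add_le _ _).trans ?_) hxy (abs_nonneg _) (by positivity)
  change |max (-(K : ℝ)) (min K x)| ≤ (K : ℝ) at hx
  change |max (-(K : ℝ)) (min K y)| ≤ (K : ℝ) at hy
  linarith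

/-- The flow over one period of the truncated equation, Lipschitz in the initial value. -/
theorem exists_flow_truncRiccati {T : ℝ} (hT : 0 < T) {g : ℝ → ℝ} (hg : Continuous g)
    (K : NNReal) :
    ∃ α : ℝ → ℝ → ℝ,
      (∀ x ∈ Icc (-(K : ℝ)) K, α x 0 = x ∧ IsSolutionOn (truncRiccati K g) (α x) (Icc 0 T)) ∧
      ContinuousOn (fun x => α x T) (Icc (-(K : ℝ)) K) := by
  obtain ⟨C, hC⟩ := isCompact_Icc.exists_bound_of_continuousOn (s := Icc 0 T) hg.continuousOn
  have hC0 : 0 ≤ C := (norm_nonneg _).trans (hC 0 ⟨le_rfl, hT.le⟩)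
  lift C to NNReal using hC0
  lift T to NNReal using hT.le
  -- The truncated field has speed at most `K² + C`, so solutions starting within `K` of `0` stay
  -- within `(K² + C) T + K` up to time `T`.
  have hpl : IsPicardLindelof (truncRiccati K g) (tmin := 0) (tmax := T) ⟨0, le_rfl, hT.le⟩ 0
      ((K ^ 2 + C) * T + K) K (K ^ 2 + C) (2 * K) :=
    { lipschitzOnWith := fun t _ => (lipschitzWith_truncRiccati K g t).lipschitzOnWith
      continuousOn := fun x _ => by unfold truncRiccati; fun_prop
      norm_le := fun t ht x _ => by
        refine (norm_add_le _ _).trans ?_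
        push_cast
        refine add_le_add ?_ (hC t ht)
        rw [norm_pow]
        exact pow_le_pow_left₀ (norm_nonneg _) (abs_trunc_le K.2 x) 2
      mul_max_le := by simp }
  obtain ⟨α, h1, L, h2⟩ := hpl.exists_forall_mem_closedBall_eq_hasDerivWithinAt_lipschitzOnWith
  have hball : Metric.closedBall (0 : ℝ) K = Icc (-(K : ℝ)) K := by
    rw [Real.closedBall_eq_Icc, zero_sub, zero_add]
  rw [hball] at h1 h2
  exact ⟨α, h1, (h2 T ⟨hT.le, le_rfl⟩).continuousOn⟩

/-! ### Existence of periodic solutions below a strict upper solution -/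

/-- Solutions cannot cross `p` upwards, nor the constant `-K` downwards once `K² > |g|`. The
truncated period map therefore sends `[-K, p 0]` to itself and has a fixed point, whose orbit never
feels the truncation. -/
theorem exists_isPeriodicSolution_of_upper {T : ℝ} (hT : 0 < T) {g : ℝ → ℝ} (hg : Continuous g)
    (hper : Function.Periodic g T) {p p' : ℝ → ℝ} (hp : ∀ t, HasDerivAt p (p' t) t)
    (hpT : p T = p 0) (hlt : ∀ t ∈ Icc 0 T, p t ^ 2 + g t < p' t) :
    ∃ φ, IsPeriodicSolution (riccati g) T φ := by
  have hpc : Continuous p := continuous_iff_continuousAt.2 fun t => (hp t).continuousAt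
  obtain ⟨C, hC⟩ := isCompact_Icc.exists_bound_of_continuousOn (s := Icc 0 T) hg.continuousOn
  obtain ⟨D, hD⟩ := isCompact_Icc.exists_bound_of_continuousOn (s := Icc 0 T) hpc.continuousOn
  have hC0 : 0 ≤ C := (norm_nonneg _).trans (hC 0 ⟨le_rfl, hT.le⟩)
  have hD0 : 0 ≤ D := (norm_nonneg _).trans (hD 0 ⟨le_rfl, hT.le⟩)
  obtain ⟨K, hK⟩ : ∃ K : NNReal, (K : ℝ) = C + D + 1 := ⟨⟨C + D + 1, by positivity⟩, rfl⟩
  have hgK : ∀ t ∈ Icc 0 T, |g t| < (K : ℝ) ^ 2 := fun t ht => by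
    have : |g t| ≤ C := hC t ht
    rw [hK]; nlinarith
  have hpK : ∀ t ∈ Icc 0 T, |p t| ≤ (K : ℝ) := fun t ht => by
    have : |p t| ≤ D := hD t ht
    rw [hK]; linarith
  obtain ⟨α, hα, hαc⟩ := exists_flow_truncRiccati hT hg K
  have h0 : (0 : ℝ) ∈ Icc 0 T := ⟨le_rfl, hT.le⟩
  have hsub : Icc (-(K : ℝ)) (p 0) ⊆ Icc (-(K : ℝ)) K :=
    Icc_subset_Icc_right ((le_abs_self _).trans (hpK 0 h0))
  have hinv : ∀ x ∈ Icc (-(K : ℝ)) (p 0), ∀ t ∈ Icc 0 T, α x t ∈ Icc (-(K : ℝ)) (p t) := by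
    intro x hx t ht
    obtain ⟨hx0, hsol⟩ := hα x (hsub hx)
    constructor
    · refine image_le_of_deriv_right_lt_deriv_boundary' (f := fun _ => -(K : ℝ)) (f' := fun _ => 0)
        continuousOn_const (fun s _ => hasDerivWithinAt_const _ _ _) (by rw [hx0]; exact hx.1)
        hsol.continuousOn (fun s hs => hsol.hasDerivWithinAt_Ici hs) (fun s hs hse => ?_) ht
      rw [← hse, truncRiccati_of_abs_le (by simp), riccati]
      have := neg_abs_le (g s)
      have := hgK s (Ico_subset_Icc_self hs)
      rw [neg_sq]
      linarith
    · refine image_le_of_deriv_right_lt_deriv_boundary' hsol.continuousOn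
        (fun s hs => hsol.hasDerivWithinAt_Ici hs) (by rw [hx0]; exact hx.2)
        hpc.continuousOn (fun s _ => (hp s).hasDerivWithinAt) (fun s hs hse => ?_) ht
      rw [hse, truncRiccati_of_abs_le (hpK s (Ico_subset_Icc_self hs))]
      exact hlt s (Ico_subset_Icc_self hs)
  obtain ⟨x, hx, hfix⟩ := exists_mem_Icc_isFixedPt_of_mapsTo (hαc.mono hsub)
    (neg_le_of_abs_le (hpK 0 h0)) (fun x hx => by
      have := hinv x hx T ⟨hT.le, le_rfl⟩
      rwa [hpT] at this)
  obtain ⟨hx0, hsol⟩ := hα x (hsub hx)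
  have hsol' : IsSolutionOn (riccati g) (α x) (Icc 0 T) := by
    intro t ht
    have hm := hinv x hx t ht
    rw [← truncRiccati_of_abs_le
      (_root_.abs_le.2 ⟨hm.1, hm.2.trans ((le_abs_self _).trans (hpK t ht))⟩)]
    exact hsol t ht
  obtain ⟨φ, hφ, -⟩ := exists_isPeriodicSolution_of_eq hT (continuous_riccati hg)
    (riccati_add_period hper) hsol' (by rw [hx0]; exact hfix)
  exact ⟨φ, hφ⟩

end RiccatiEq

namespace RiccatiEq

open Set Filter Topology

/-! ### The weight -/

theorem weight_pos (p : ℝ → ℝ) (t : ℝ) : 0 < weight p t := Real.exp_pos _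

theorem weight_zero (p : ℝ → ℝ) : weight p 0 = 1 := by simp [weight]

theorem hasDerivAt_weight {p : ℝ → ℝ} (hp : Continuous p) (t : ℝ) :
    HasDerivAt (weight p) (-2 * p t * weight p t) t := by
  have := ((hp.integral_hasStrictDerivAt 0 t).hasDerivAt.const_mul (-2)).exp
  exact this.congr_deriv (by simp only [weight]; ring)

theorem continuous_weight {p : ℝ → ℝ} (hp : Continuous p) : Continuous (weight p) :=
  continuous_iff_continuousAt.2 fun t => (hasDerivAt_weight hp t).continuousAt

theorem weight_eq_one_iff {p : ℝ → ℝ} {T : ℝ} (hT : 0 < T) : weight p T = 1 ↔ mean T p = 0 := by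
  simp [weight, mean, hT.ne']

/-! ### The principal periodic solution -/

/-- A periodic solution with nonzero average persists under a small increase of the forcing term. -/
theorem exists_gt_of_mean_ne_zero {T c : ℝ} (hT : 0 < T) {g ψ : ℝ → ℝ} (hg : Continuous g)
    (hper : Function.Periodic g T) (hψ : IsPeriodicSolution (riccati fun t => g t + c) T ψ)
    (hm : mean T ψ ≠ 0) :
    ∃ c' > c, ∃ φ, IsPeriodicSolution (riccati fun t => g t + c') T φ := by
  have hψc := hψ.2.continuous
  have hWc := continuous_weight hψc
  have hW1 : weight ψ T - 1 ≠ 0 := sub_ne_zero.2 (mt (weight_eq_one_iff hT).1 hm)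
  -- The function `z` solves the linearization `z' = 2ψz + 1`. This initial value makes it periodic,
  -- and exists because `weight ψ T ≠ 1`.
  set z₀ : ℝ := (∫ s in (0 : ℝ)..T, weight ψ s) / (weight ψ T - 1) with hz₀
  let z : ℝ → ℝ := fun t => (z₀ + ∫ s in (0 : ℝ)..t, weight ψ s) / weight ψ t
  have hz : ∀ t, HasDerivAt z (2 * ψ t * z t + 1) t := by
    intro t
    have := ((hWc.integral_hasStrictDerivAt 0 t).hasDerivAt.const_add z₀).div
      (hasDerivAt_weight hψc t) (weight_pos ψ t).ne'
    refine this.congr_deriv ?_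
    have := (weight_pos ψ t).ne'
    simp only [z]
    field_simp
    ring
  have hzT : z T = z 0 := by
    have := (weight_pos ψ T).ne'
    simp only [z, weight_zero, intervalIntegral.integral_same, add_zero, div_one]
    rw [div_eq_iff this, hz₀]
    field_simp
    ring
  have hzc : Continuous z := continuous_iff_continuousAt.2 fun t => (hz t).continuousAt
  obtain ⟨M, hM⟩ := isCompact_Icc.exists_bound_of_continuousOn (s := Icc 0 T) hzc.continuousOn
  -- For `p = ψ + s z` the margin `p' - p² - g - (c + s/2)` equals `s/2 - s² z²`, positive when `s
  -- z² < 1/2`.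
  set s : ℝ := 1 / (2 * (M ^ 2 + 1)) with hs
  have hs0 : 0 < s := by positivity
  refine ⟨c + s / 2, by linarith, exists_isPeriodicSolution_of_upper hT
    (p := fun t => ψ t + s * z t) (by fun_prop) (fun t => by simp only [hper t])
    (fun t => (hψ.2.hasDerivAt t).add ((hz t).const_mul s)) ?_ fun t ht => ?_⟩
  · have h := hψ.1 0
    rw [zero_add] at h
    simp only [hzT, h]
  · have hz2 : z t ^ 2 ≤ M ^ 2 := sq_le_sq' (neg_le_of_abs_le (hM t ht)) (le_of_abs_le (hM t ht))
    have hsM : s * (M ^ 2 + 1) = 1 / 2 := by rw [hs]; field_simp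
    have : s * z t ^ 2 < 1 / 2 := by nlinarith
    simp only [riccati]
    nlinarith

/-- The set of constants `c` for which `x' = x² + g + c` has a periodic solution is closed under
limits of sequences. -/
theorem exists_isPeriodicSolution_of_tendsto {T c : ℝ} (hT : 0 < T) {g : ℝ → ℝ}
    (hg : Continuous g) (hper : Function.Periodic g T) {u : ℕ → ℝ} (hu : Tendsto u atTop (𝓝 c))
    (hsol : ∀ n, ∃ φ, IsPeriodicSolution (riccati fun t => g t + u n) T φ) :
    ∃ φ, IsPeriodicSolution (riccati fun t => g t + c) T φ := by
  choose x hx using hsol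
  obtain ⟨C, hC⟩ := (hper.isBounded_of_continuous hT.ne' hg).exists_norm_le
  have hC' : ∀ t, |g t| ≤ C := fun t => hC _ (mem_range_self t)
  obtain ⟨D, hD⟩ := (Metric.isBounded_range_of_tendsto u hu).exists_norm_le
  have hD' : ∀ n, |u n| ≤ D := fun n => hD _ (mem_range_self n)
  have hC0 : 0 ≤ C := (abs_nonneg _).trans (hC' 0)
  have hD0 : 0 ≤ D := (abs_nonneg _).trans (hD' 0)
  obtain ⟨K, hK⟩ : ∃ K : NNReal, (K : ℝ) = C + D + 1 := ⟨⟨C + D + 1, by positivity⟩, rfl⟩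
  have hxK : ∀ n t, |x n t| ≤ (K : ℝ) := fun n t =>
    (hx n).abs_le hT K.2 (fun s => (abs_add_le _ _).trans (by
      change |g s| + |u n| ≤ (K : ℝ) ^ 2
      have := hC' s
      have := hD' n
      rw [hK]; nlinarith)) t
  obtain ⟨a, ha, σ, hσ, hlim⟩ := isCompact_Icc.tendsto_subseq (x := fun n => x n 0)
    (fun n => _root_.abs_le.1 (hxK n 0))
  obtain ⟨α, hα, -⟩ := exists_flow_truncRiccati hT (g := fun t => g t + c) (by fun_prop) K
  obtain ⟨hα0, hαs⟩ := hα a ha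
  -- Each `x n` solves the limit equation up to the error `|u n - c|`, so Grönwall's inequality
  -- bounds its distance to the limit trajectory.
  have hbound : ∀ n, ∀ t ∈ Icc 0 T,
      dist (x n t) (α a t) ≤ gronwallBound (dist (x n 0) a) (2 * K : NNReal) (|u n - c| + 0)
        (t - 0) := by
    intro n
    refine dist_le_of_approx_trajectories_ODE (v := truncRiccati K fun t => g t + c)
      (lipschitzWith_truncRiccati K _) (hx n).2.continuous.continuousOn
      (fun t _ => ((hx n).2.hasDerivAt t).hasDerivWithinAt) (fun t _ => ?_) hαs.continuousOn
      (fun t ht => hαs.hasDerivWithinAt_Ici ht) (fun t _ => (dist_self _).le) (by rw [hα0])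
    rw [truncRiccati_of_abs_le (hxK n t), Real.dist_eq]
    exact le_of_eq (by simp only [riccati]; congr 1; ring)
  have hconv : ∀ t ∈ Icc 0 T, Tendsto (fun n => x (σ n) t) atTop (𝓝 (α a t)) := by
    intro t ht
    rw [tendsto_iff_dist_tendsto_zero]
    refine squeeze_zero (fun _ => dist_nonneg) (fun n => hbound (σ n) t ht) ?_
    have hK0 : ((2 * K : NNReal) : ℝ) ≠ 0 := by
      push_cast
      rw [hK]; positivity
    have h1 : Tendsto (fun n => dist (x (σ n) 0) a) atTop (𝓝 0) :=
      tendsto_iff_dist_tendsto_zero.1 hlim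
    have h2 : Tendsto (fun n => |u (σ n) - c| + 0) atTop (𝓝 0) := by
      simpa using (((hu.comp hσ.tendsto_atTop).sub_const c).abs)
    simp only [gronwallBound_of_K_ne_0 hK0]
    simpa using (h1.mul_const _).add ((h2.div_const _).mul_const _)
  have hαK : ∀ t ∈ Icc 0 T, |α a t| ≤ (K : ℝ) := fun t ht =>
    le_of_tendsto (hconv t ht).abs (Eventually.of_forall fun n => hxK _ t)
  have hαT : α a T = α a 0 := by
    refine tendsto_nhds_unique (hconv T ⟨hT.le, le_rfl⟩)
      ((hconv 0 ⟨le_rfl, hT.le⟩).congr fun n => ?_)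
    have h := (hx (σ n)).1 0
    rw [zero_add] at h
    exact h.symm
  obtain ⟨φ, hφ, -⟩ := exists_isPeriodicSolution_of_eq hT
    (continuous_riccati (γ := fun t => g t + c) (by fun_prop))
    (riccati_add_period fun t => by simp only [hper t]) (x := α a)
    (fun t ht => by
      rw [← truncRiccati_of_abs_le (hαK t ht)]
      exact hαs t ht) hαT
  exact ⟨φ, hφ⟩

/-- For some constant `c` the equation `x' = x² + g + c` has a periodic solution of average zero. -/
theorem exists_principal {T : ℝ} (hT : 0 < T) {g : ℝ → ℝ} (hg : Continuous g)
    (hper : Function.Periodic g T) :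
    ∃ c φ, IsPeriodicSolution (riccati fun t => g t + c) T φ ∧ mean T φ = 0 := by
  obtain ⟨C, hC⟩ := (hper.isBounded_of_continuous hT.ne' hg).exists_norm_le
  have hC' : ∀ t, |g t| ≤ C := fun t => hC _ (mem_range_self t)
  let S : Set ℝ := {c | ∃ φ, IsPeriodicSolution (riccati fun t => g t + c) T φ}
  have hne : S.Nonempty := by
    refine ⟨-C - 1, exists_isPeriodicSolution_of_upper hT (p := fun _ => 0) (p' := fun _ => 0)
      (by fun_prop) (fun t => by simp only [hper t]) (fun t => hasDerivAt_const _ _) rfl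
      fun t _ => ?_⟩
    have := le_of_abs_le (hC' t)
    linarith
  -- For `c > C` the right-hand side is positive, so solutions are strictly increasing and cannot be
  -- periodic.
  have hbdd : BddAbove S := by
    refine ⟨C, fun c ⟨φ, hφ⟩ => ?_⟩
    by_contra! hc
    have hmono : StrictMono φ := strictMono_of_deriv_pos fun t => by
      rw [(hφ.2.hasDerivAt t).deriv, riccati]
      have := neg_le_of_abs_le (hC' t)
      nlinarith [sq_nonneg (φ t)]
    have h := hφ.1 0
    exact (hmono (by linarith : (0 : ℝ) < 0 + T)).ne' h
  obtain ⟨u, -, hu, huS⟩ := exists_seq_tendsto_sSup hne hbdd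
  obtain ⟨φ, hφ⟩ := exists_isPeriodicSolution_of_tendsto hT hg hper hu huS
  refine ⟨sSup S, φ, hφ, ?_⟩
  by_contra hm
  obtain ⟨c', hc', h⟩ := exists_gt_of_mean_ne_zero hT hg hper hφ hm
  exact (le_csSup hbdd h).not_gt hc'

end RiccatiEq

namespace RiccatiEq

open Set Filter Topology

/-! ### The functionals `muLower` and `muUpper` -/

theorem centered_add_mean (T : ℝ) (γ : ℝ → ℝ) : (fun t => centered T γ t + mean T γ) = γ :=
  funext fun _ => sub_add_cancel _ _

theorem continuous_centered {T : ℝ} {γ : ℝ → ℝ} (hγ : Continuous γ) :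
    Continuous (centered T γ) :=
  hγ.sub continuous_const

theorem weight_eq_one_of_mem_C1T0 {T : ℝ} (hT : 0 < T) {q : ℝ → ℝ} (hq : q ∈ C1T0 T) :
    weight q T = 1 :=
  (weight_eq_one_iff hT).2 hq.2

theorem apply_period {T : ℝ} {p : ℝ → ℝ} (hp : Function.Periodic p T) : p T = p 0 := by
  have := hp 0
  rwa [zero_add] at this

theorem muLower_of_isPeriodicSolution {T c : ℝ} (hT : 0 < T) {γ φ : ℝ → ℝ}
    (hφ : IsPeriodicSolution (riccati fun t => centered T γ t + c) T φ) : muLower T γ φ = c := by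
  have : (fun t => φ t ^ 2 + centered T γ t - deriv φ t) = fun _ => -c := by
    funext t
    rw [(hφ.2.hasDerivAt t).deriv, riccati]
    ring
  rw [muLower, this, (nonempty_Icc.2 hT.le).image_const, csSup_singleton, neg_neg]

/-- If `muLower T γ p > c`, then `(p - φ) * weight φ` is strictly increasing: the weight cancels the
term `2φ(p - φ)` and leaves a square plus a positive margin. Zero average of `φ` makes its values at
`0` and `T` equal, a contradiction. -/
theorem muLower_le {T c : ℝ} (hT : 0 < T) {γ φ p : ℝ → ℝ} (hγ : Continuous γ)
    (hφ : IsPeriodicSolution (riccati fun t => centered T γ t + c) T φ) (hm : mean T φ = 0)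
    (hp : p ∈ C1T T) : muLower T γ p ≤ c := by
  have hpc : Continuous fun t => p t ^ 2 + centered T γ t - deriv p t :=
    ((hp.1.continuous.pow 2).add (continuous_centered hγ)).sub (hp.1.continuous_deriv le_rfl)
  have hφc := hφ.2.continuous
  have hsup : ∀ t ∈ Icc 0 T, muLower T γ p ≤ -(p t ^ 2 + centered T γ t - deriv p t) :=
    fun t ht => neg_le_neg (le_csSup (isCompact_Icc.image hpc).bddAbove (mem_image_of_mem _ ht))
  by_contra! hlt
  have hd : ∀ t, HasDerivAt (fun t => (p t - φ t) * weight φ t)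
      (weight φ t * ((p t - φ t) ^ 2 + (deriv p t - p t ^ 2 - centered T γ t - c))) t := fun t =>
    ((((hp.1.differentiable one_ne_zero) t).hasDerivAt.sub (hφ.2.hasDerivAt t)).mul
      (hasDerivAt_weight hφc t)).congr_deriv (by simp only [riccati, Pi.sub_apply]; ring)
  have hmono : StrictMonoOn (fun t => (p t - φ t) * weight φ t) (Icc 0 T) := by
    refine strictMonoOn_of_deriv_pos (convex_Icc 0 T)
      (continuous_iff_continuousAt.2 fun t => (hd t).continuousAt).continuousOn fun t ht => ?_
    rw [(hd t).deriv]
    have := hsup t (interior_subset ht)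
    exact mul_pos (weight_pos _ _) (by nlinarith [sq_nonneg (p t - φ t)])
  have h := hmono ⟨le_rfl, hT.le⟩ ⟨hT.le, le_rfl⟩ hT
  simp only [weight_zero, (weight_eq_one_iff hT).2 hm, apply_period hp.2, apply_period hφ.1] at h
  exact lt_irrefl _ h

theorem integral_weight_pos {T : ℝ} (hT : 0 < T) {q : ℝ → ℝ} (hq : Continuous q) :
    0 < ∫ t in (0 : ℝ)..T, weight q t :=
  intervalIntegral.intervalIntegral_pos_of_pos
    ((continuous_weight hq).intervalIntegrable _ _) (weight_pos q) hT

/-- Integrate the derivative of `φ * weight q` over a period. Boundary terms cancel because `q` has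
zero average, and completing the square in `φ² - 2qφ` gives the remainder. -/
theorem muUpper_eq {T c : ℝ} (hT : 0 < T) {γ φ q : ℝ → ℝ} (hγ : Continuous γ)
    (hφ : IsPeriodicSolution (riccati fun t => centered T γ t + c) T φ) (hq : q ∈ C1T0 T) :
    muUpper T γ q = c + (∫ t in (0 : ℝ)..T, weight q t)⁻¹ *
      ∫ t in (0 : ℝ)..T, weight q t * (φ t - q t) ^ 2 := by
  have hqc := hq.1.1.continuous
  have hφc := hφ.2.continuous
  have hWc := continuous_weight hqc
  have hcc := continuous_centered (T := T) hγ
  have hpos := integral_weight_pos hT hqc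
  have h0 : ∫ t in (0 : ℝ)..T, (weight q t * (φ t - q t) ^ 2 + c * weight q t
      - weight q t * (q t ^ 2 - centered T γ t)) = 0 := by
    rw [intervalIntegral.integral_eq_sub_of_hasDerivAt (f := fun t => φ t * weight q t)
      (fun t _ => ((hφ.2.hasDerivAt t).mul (hasDerivAt_weight hqc t)).congr_deriv (by
        simp only [riccati]; ring)) (Continuous.intervalIntegrable (by fun_prop) _ _)]
    simp [weight_zero, weight_eq_one_of_mem_C1T0 hT hq, apply_period hφ.1]
  rw [intervalIntegral.integral_sub (Continuous.intervalIntegrable (by fun_prop) _ _)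
      (Continuous.intervalIntegrable (by fun_prop) _ _),
    intervalIntegral.integral_add (Continuous.intervalIntegrable (by fun_prop) _ _)
      (Continuous.intervalIntegrable (by fun_prop) _ _),
    intervalIntegral.integral_const_mul] at h0
  rw [muUpper, ← sub_eq_zero.1 h0]
  field_simp
  ring

theorem le_muUpper {T c : ℝ} (hT : 0 < T) {γ φ q : ℝ → ℝ} (hγ : Continuous γ)
    (hφ : IsPeriodicSolution (riccati fun t => centered T γ t + c) T φ) (hq : q ∈ C1T0 T) :
    c ≤ muUpper T γ q := by
  rw [muUpper_eq hT hγ hφ hq]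
  refine le_add_of_nonneg_right (mul_nonneg
    (inv_nonneg.2 (integral_weight_pos hT hq.1.1.continuous).le)
    (intervalIntegral.integral_nonneg hT.le fun t _ =>
      mul_nonneg (weight_pos q t).le (sq_nonneg _)))

theorem muUpper_of_isPeriodicSolution {T c : ℝ} (hT : 0 < T) {γ φ : ℝ → ℝ} (hγ : Continuous γ)
    (hφ : IsPeriodicSolution (riccati fun t => centered T γ t + c) T φ) (hm : mean T φ = 0) :
    muUpper T γ φ = c := by
  rw [muUpper_eq hT hγ hφ ⟨hφ.mem_C1T ((continuous_centered hγ).add continuous_const), hm⟩]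
  simp

/-- Existence of the maximum of `muLower` and of the minimum of `muUpper`, both attained at a
periodic solution with average zero. -/
theorem exists_extremal {T : ℝ} (hT : 0 < T) {γ : ℝ → ℝ} (hγ : Continuous γ)
    (hper : Function.Periodic γ T) :
    IsGreatest (muLower T γ '' C1T T) (gammaStar T γ) ∧
      IsLeast (muUpper T γ '' C1T0 T) (gammaStar T γ) ∧
      ∃ φ, IsPeriodicSolution (riccati fun t => centered T γ t + gammaStar T γ) T φ ∧
        mean T φ = 0 := by
  obtain ⟨c, φ, hφ, hm⟩ := exists_principal hT (continuous_centered (T := T) hγ)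
    (fun t => by simp only [centered, hper t])
  have hφC := hφ.mem_C1T ((continuous_centered hγ).add continuous_const)
  have hgr : IsGreatest (muLower T γ '' C1T T) c :=
    ⟨⟨φ, hφC, muLower_of_isPeriodicSolution hT hφ⟩, by
      rintro _ ⟨p, hp, rfl⟩
      exact muLower_le hT hγ hφ hm hp⟩
  have hc : gammaStar T γ = c := hgr.csSup_eq
  rw [hc]
  refine ⟨hgr, ⟨⟨φ, ⟨hφC, hm⟩, muUpper_of_isPeriodicSolution hT hγ hφ hm⟩, ?_⟩, φ, hφ, hm⟩
  rintro _ ⟨q, hq, rfl⟩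
  exact le_muUpper hT hγ hφ hq

/-! ### Solutions in terms of a periodic solution -/

/-- The primitive of `exp(2 ∫₀ᵗ p)` vanishing at `0`. -/
noncomputable def invWeightPrimitive (p : ℝ → ℝ) (t : ℝ) : ℝ := ∫ s in (0 : ℝ)..t, (weight p s)⁻¹

theorem continuous_inv_weight {p : ℝ → ℝ} (hp : Continuous p) :
    Continuous fun s => (weight p s)⁻¹ :=
  (continuous_weight hp).inv₀ fun s => (weight_pos p s).ne'

theorem hasDerivAt_invWeightPrimitive {p : ℝ → ℝ} (hp : Continuous p) (t : ℝ) :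
    HasDerivAt (invWeightPrimitive p) (weight p t)⁻¹ t :=
  ((continuous_inv_weight hp).integral_hasStrictDerivAt 0 t).hasDerivAt

theorem invWeightPrimitive_zero (p : ℝ → ℝ) : invWeightPrimitive p 0 = 0 := by
  simp [invWeightPrimitive]

theorem strictMono_invWeightPrimitive {p : ℝ → ℝ} (hp : Continuous p) :
    StrictMono (invWeightPrimitive p) :=
  strictMono_of_deriv_pos fun t => by
    rw [(hasDerivAt_invWeightPrimitive hp t).deriv]
    exact inv_pos.2 (weight_pos p t)

theorem invWeightPrimitive_pos {p : ℝ → ℝ} (hp : Continuous p) {T : ℝ} (hT : 0 < T) :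
    0 < invWeightPrimitive p T := by
  simpa [invWeightPrimitive_zero] using strictMono_invWeightPrimitive hp hT

/-- The solution starting at distance `v` from the solution `ψ`. -/
noncomputable def shiftedSolution (ψ : ℝ → ℝ) (v t : ℝ) : ℝ :=
  ψ t + v / (weight ψ t * (1 - v * invWeightPrimitive ψ t))

theorem shiftedSolution_zero (ψ : ℝ → ℝ) (v : ℝ) : shiftedSolution ψ v 0 = ψ 0 + v := by
  simp [shiftedSolution, weight_zero, invWeightPrimitive_zero]

/-- The difference `y = x - ψ` satisfies the Bernoulli equation `y' = 2ψy + y²`, so `1/y` solves a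
linear equation. The condition on `s` excludes blow-up. -/
theorem isSolutionOn_shiftedSolution {γ ψ : ℝ → ℝ} (hψ : IsSolutionOn (riccati γ) ψ univ) {v : ℝ}
    {s : Set ℝ} (hs : ∀ t ∈ s, 1 - v * invWeightPrimitive ψ t ≠ 0) :
    IsSolutionOn (riccati γ) (shiftedSolution ψ v) s := by
  intro t ht
  have hψc := hψ.continuous
  have hW := (weight_pos ψ t).ne'
  have hB := hs t ht
  have h := (hψ.hasDerivAt t).add ((hasDerivAt_const t v).div ((hasDerivAt_weight hψc t).mul
    (((hasDerivAt_invWeightPrimitive hψc t).const_mul v).const_sub 1)) (mul_ne_zero hW hB))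
  refine (h.congr_deriv ?_).hasDerivWithinAt
  simp only [riccati, shiftedSolution, Pi.mul_apply]
  field_simp
  ring

/-- A solution on `[0, T]` is determined by its initial distance from `ψ`. -/
theorem solution_formula {γ ψ x : ℝ → ℝ} {T : ℝ} (hψ : IsSolutionOn (riccati γ) ψ univ)
    (hx : IsSolutionOn (riccati γ) x (Icc 0 T)) {t : ℝ} (ht : t ∈ Icc 0 T) :
    weight ψ t * (x t - ψ t) * (1 - (x 0 - ψ 0) * invWeightPrimitive ψ t) = x 0 - ψ 0 := by
  have hψc := hψ.continuous
  set v := x 0 - ψ 0 with hv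
  obtain ⟨K, hK⟩ := isCompact_Icc.exists_bound_of_continuousOn
    (hx.continuousOn.sub hψc.continuousOn)
  -- `G` satisfies the linear equation `G' = (x - ψ) G` with `G 0 = 0`, hence vanishes. No division
  -- occurs, so nothing need be known about zeros of the denominator.
  let G : ℝ → ℝ := fun t => weight ψ t * (x t - ψ t) * (1 - v * invWeightPrimitive ψ t) - v
  have hG : ∀ t ∈ Icc 0 T, HasDerivWithinAt G ((x t - ψ t) * G t) (Icc 0 T) t := by
    intro t ht
    have hW := (weight_pos ψ t).ne'
    have h := ((((hasDerivAt_weight hψc t).hasDerivWithinAt (s := Icc 0 T)).mul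
      ((hx t ht).sub (hψ.hasDerivAt t).hasDerivWithinAt)).mul
      (((hasDerivAt_invWeightPrimitive hψc t).const_mul v).const_sub 1).hasDerivWithinAt).sub_const v
    refine h.congr_deriv ?_
    simp only [riccati, G, Pi.mul_apply, Pi.sub_apply]
    field_simp
    ring
  have := eq_zero_of_abs_deriv_le_mul_abs_self_of_eq_zero_right (f := G) (K := K)
    (fun t ht => (hG t ht).continuousWithinAt)
    (fun t ht => (hG t (Ico_subset_Icc_self ht)).mono_of_mem_nhdsWithin (Icc_mem_nhdsGE_of_mem ht))
    (by simp [G, weight_zero, invWeightPrimitive_zero, hv])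
    (fun t ht => by
      rw [norm_mul]
      exact mul_le_mul_of_nonneg_right (hK t (Ico_subset_Icc_self ht)) (norm_nonneg _)) t ht
  simp only [G] at this
  linarith

theorem solution_eq_shiftedSolution {γ ψ x : ℝ → ℝ} {T : ℝ}
    (hψ : IsSolutionOn (riccati γ) ψ univ) (hx : IsSolutionOn (riccati γ) x (Icc 0 T)) {t : ℝ}
    (ht : t ∈ Icc 0 T) : x t = shiftedSolution ψ (x 0 - ψ 0) t := by
  have h := solution_formula hψ hx ht
  have hW := (weight_pos ψ t).ne'
  by_cases hv : x 0 - ψ 0 = 0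
  · simp only [hv, zero_mul, sub_zero, mul_one, mul_eq_zero, hW, false_or] at h
    simp only [shiftedSolution, hv, zero_div]
    linarith
  · have hB : 1 - (x 0 - ψ 0) * invWeightPrimitive ψ t ≠ 0 := fun h0 => by
      rw [h0, mul_zero] at h
      exact hv h.symm
    rw [shiftedSolution, ← sub_eq_iff_eq_add', eq_div_iff (mul_ne_zero hW hB)]
    linarith

theorem IsPeriodicSolution.eq_of_apply_zero {γ ψ φ : ℝ → ℝ} {T : ℝ} (hT : 0 < T)
    (hψ : IsPeriodicSolution (riccati γ) T ψ) (hφ : IsPeriodicSolution (riccati γ) T φ)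
    (h0 : φ 0 = ψ 0) : φ = ψ := by
  have hp : Function.Periodic (fun t => φ t - ψ t) T := fun t => by simp only [hφ.1 t, hψ.1 t]
  funext t
  obtain ⟨s, hs, hst⟩ := hp.exists_mem_Ico₀ hT t
  have := solution_eq_shiftedSolution hψ.2 (hφ.2.mono (subset_univ (Icc 0 T)))
    (Ico_subset_Icc_self hs)
  rw [h0, sub_self, shiftedSolution, zero_div, add_zero] at this
  rw [this, sub_self] at hst
  linarith

/-- The initial distances between two periodic solutions. -/
theorem IsPeriodicSolution.apply_zero_eq {γ ψ φ : ℝ → ℝ} {T : ℝ} (hT : 0 < T)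
    (hψ : IsPeriodicSolution (riccati γ) T ψ) (hφ : IsPeriodicSolution (riccati γ) T φ) :
    φ 0 = ψ 0 ∨ weight ψ T * (1 - (φ 0 - ψ 0) * invWeightPrimitive ψ T) = 1 := by
  have h := solution_formula hψ.2 (hφ.2.mono (subset_univ (Icc 0 T))) ⟨hT.le, le_rfl⟩
  rw [apply_period hψ.1, apply_period hφ.1] at h
  rcases eq_or_ne (φ 0 - ψ 0) 0 with h0 | h0
  · exact Or.inl (sub_eq_zero.1 h0)
  · refine Or.inr (mul_right_cancel₀ h0 ?_)
    linarith

/-! ### The displacement map -/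

theorem one_sub_mul_invWeightPrimitive_pos {ψ : ℝ → ℝ} (hψ : Continuous ψ) {v T t : ℝ}
    (hv : v * invWeightPrimitive ψ T < 1) (ht : t ∈ Icc 0 T) :
    0 < 1 - v * invWeightPrimitive ψ t := by
  have hmono := (strictMono_invWeightPrimitive hψ).monotone
  have h0 := hmono ht.1
  have h1 := hmono ht.2
  rw [invWeightPrimitive_zero] at h0
  rcases le_total v 0 with h | h <;> nlinarith

/-- The solution chosen in `poincareMap` is arbitrary, but `solution_eq_shiftedSolution` applies to
any of them. The bound on `v` keeps the denominator positive on all of `[0, T]`. -/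
theorem displacement_eq {γ ψ : ℝ → ℝ} {T v : ℝ} (hT : 0 < T)
    (hψ : IsPeriodicSolution (riccati γ) T ψ) (hv : v * invWeightPrimitive ψ T < 1) :
    displacement (riccati γ) T (ψ 0 + v) =
      v / (weight ψ T * (1 - v * invWeightPrimitive ψ T)) - v := by
  have hex : ∃ x : ℝ → ℝ, x 0 = ψ 0 + v ∧ IsSolutionOn (riccati γ) x (Icc 0 T) :=
    ⟨shiftedSolution ψ v, shiftedSolution_zero ψ v, isSolutionOn_shiftedSolution hψ.2 fun t ht =>
      (one_sub_mul_invWeightPrimitive_pos hψ.2.continuous hv ht).ne'⟩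
  have h := solution_eq_shiftedSolution hψ.2 hex.choose_spec.2 ⟨hT.le, le_rfl⟩
  rw [hex.choose_spec.1, add_sub_cancel_left] at h
  rw [displacement, poincareMap, dif_pos hex, h, shiftedSolution, apply_period hψ.1]
  ring

theorem displacement_eventuallyEq {γ ψ : ℝ → ℝ} {T : ℝ} (hT : 0 < T)
    (hψ : IsPeriodicSolution (riccati γ) T ψ) :
    displacement (riccati γ) T =ᶠ[𝓝 (ψ 0)] fun x =>
      (x - ψ 0) / (weight ψ T * (1 - (x - ψ 0) * invWeightPrimitive ψ T)) - (x - ψ 0) := by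
  have hc : Continuous fun x => (x - ψ 0) * invWeightPrimitive ψ T := by fun_prop
  filter_upwards [hc.continuousAt.eventually_lt continuousAt_const (by simp :
    (ψ 0 - ψ 0) * invWeightPrimitive ψ T < 1)] with x hx
  rw [← displacement_eq hT hψ hx, add_sub_cancel]

theorem hasDerivAt_displacement_formula {a W B x : ℝ} (hW : W ≠ 0) (hx : 1 - (x - a) * B ≠ 0) :
    HasDerivAt (fun x => (x - a) / (W * (1 - (x - a) * B)) - (x - a))
      (1 / (W * (1 - (x - a) * B) ^ 2) - 1) x := by
  have h := ((hasDerivAt_id x).sub_const a)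
  refine ((h.div (((h.mul_const B).const_sub 1).const_mul W) (mul_ne_zero hW hx)).sub h).congr_deriv
    ?_
  simp only [id]
  field_simp
  ring

theorem contDiffAt_displacement {γ ψ : ℝ → ℝ} {T : ℝ} (hT : 0 < T)
    (hψ : IsPeriodicSolution (riccati γ) T ψ) (n : ℕ) :
    ContDiffAt ℝ n (displacement (riccati γ) T) (ψ 0) := by
  refine ContDiffAt.congr_of_eventuallyEq ?_ (displacement_eventuallyEq hT hψ)
  have := (weight_pos ψ T).ne'
  exact (ContDiffAt.div (by fun_prop) (by fun_prop) (by simpa)).sub (by fun_prop)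

theorem displacement_apply_zero {γ ψ : ℝ → ℝ} {T : ℝ} (hT : 0 < T)
    (hψ : IsPeriodicSolution (riccati γ) T ψ) : displacement (riccati γ) T (ψ 0) = 0 := by
  rw [(displacement_eventuallyEq hT hψ).eq_of_nhds]
  simp

theorem deriv_displacement_eventuallyEq {γ ψ : ℝ → ℝ} {T : ℝ} (hT : 0 < T)
    (hψ : IsPeriodicSolution (riccati γ) T ψ) :
    deriv (displacement (riccati γ) T) =ᶠ[𝓝 (ψ 0)] fun x =>
      1 / (weight ψ T * (1 - (x - ψ 0) * invWeightPrimitive ψ T) ^ 2) - 1 := by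
  have hc : Continuous fun x => 1 - (x - ψ 0) * invWeightPrimitive ψ T := by fun_prop
  filter_upwards [(displacement_eventuallyEq hT hψ).eventuallyEq_nhds,
    hc.continuousAt.eventually_ne (by simp : 1 - (ψ 0 - ψ 0) * invWeightPrimitive ψ T ≠ 0)]
    with x h1 h2
  rw [h1.deriv_eq, (hasDerivAt_displacement_formula (weight_pos ψ T).ne' h2).deriv]

/-- The derivative of the displacement at `ψ 0` is `1 / weight ψ T - 1`. -/
theorem IsPeriodicSolution.isHyperbolic {γ ψ : ℝ → ℝ} {T : ℝ} (hT : 0 < T)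
    (hψ : IsPeriodicSolution (riccati γ) T ψ) (hm : mean T ψ ≠ 0) :
    IsHyperbolic (riccati γ) T ψ := by
  refine ⟨contDiffAt_displacement hT hψ 1, fun k hk => ?_, ?_⟩
  · obtain rfl : k = 0 := by omega
    rw [iteratedDeriv_zero, displacement_apply_zero hT hψ]
  · rw [iteratedDeriv_one, (deriv_displacement_eventuallyEq hT hψ).eq_of_nhds]
    have := mt (weight_eq_one_iff hT).1 hm
    simpa [sub_eq_zero] using this

/-- With `weight ψ T = 1` the displacement is `v / (1 - v B) - v = B v² + ⋯`, where `B =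
invWeightPrimitive ψ T > 0`. -/
theorem IsPeriodicSolution.isDouble {γ ψ : ℝ → ℝ} {T : ℝ} (hT : 0 < T)
    (hψ : IsPeriodicSolution (riccati γ) T ψ) (hm : mean T ψ = 0) :
    IsDouble (riccati γ) T ψ := by
  have hW : weight ψ T = 1 := (weight_eq_one_iff hT).2 hm
  refine ⟨contDiffAt_displacement hT hψ 2, fun k hk => ?_, ?_⟩
  · interval_cases k
    · rw [iteratedDeriv_zero, displacement_apply_zero hT hψ]
    · rw [iteratedDeriv_one, (deriv_displacement_eventuallyEq hT hψ).eq_of_nhds]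
      simp [hW]
  · rw [iteratedDeriv_succ, iteratedDeriv_one, (deriv_displacement_eventuallyEq hT hψ).deriv_eq, hW]
    have h := ((hasDerivAt_id (ψ 0)).sub_const (ψ 0)).mul_const (invWeightPrimitive ψ T)
    have h2 := ((((h.const_sub 1).pow 2).const_mul 1).inv (by simp)).sub_const 1
    have h3 : HasDerivAt
        (fun x => 1 / (1 * (1 - (x - ψ 0) * invWeightPrimitive ψ T) ^ 2) - 1)
        (2 * invWeightPrimitive ψ T) (ψ 0) :=
      (h2.congr_deriv (by simp)).congr_of_eventuallyEq
        (Eventually.of_forall fun x => by simp)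
    rw [h3.deriv]
    exact mul_ne_zero two_ne_zero (invWeightPrimitive_pos hψ.2.continuous hT).ne'

/-! ### Semi-stability -/

theorem periodic_weight {T : ℝ} (hT : 0 < T) {p : ℝ → ℝ} (hp : Continuous p)
    (hper : Function.Periodic p T) (hm : mean T p = 0) : Function.Periodic (weight p) T := by
  intro t
  have h0 : ∫ s in (0 : ℝ)..T, p s = 0 := by simpa [mean, hT.ne'] using hm
  have h1 := hper.intervalIntegral_add_eq t 0
  rw [zero_add, h0] at h1
  have h2 := intervalIntegral.integral_add_adjacent_intervals
    (hp.intervalIntegrable (μ := MeasureTheory.volume) 0 t) (hp.intervalIntegrable t (t + T))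
  rw [weight, weight, ← h2, h1, add_zero]

/-- Zero average makes the weight periodic, so its inverse is bounded and `invWeightPrimitive ψ`
tends to `±∞` with `t`. Then `v / (weight * (1 - v * invWeightPrimitive))` tends to `0` forwards for
`v < 0` and backwards for `v > 0`, with no blow-up on the way. -/
theorem IsPeriodicSolution.isSemistable {γ ψ : ℝ → ℝ} {T : ℝ} (hT : 0 < T)
    (hψ : IsPeriodicSolution (riccati γ) T ψ) (hm : mean T ψ = 0) :
    IsSemistable (riccati γ) ψ := by
  have hψc := hψ.2.continuous
  have hmono := (strictMono_invWeightPrimitive hψc).monotone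
  have hper : Function.Periodic (fun s => (weight ψ s)⁻¹) T := fun t => by
    simp only [periodic_weight hT hψc hψ.1 hm t]
  have hint := (continuous_inv_weight hψc).intervalIntegrable (μ := MeasureTheory.volume) 0 T
  have hpos : ∀ s, 0 < (weight ψ s)⁻¹ := fun s => inv_pos.2 (weight_pos ψ s)
  have htop : Tendsto (invWeightPrimitive ψ) atTop atTop :=
    hper.tendsto_atTop_intervalIntegral_of_pos' hint hpos hT
  have hbot : Tendsto (invWeightPrimitive ψ) atBot atBot :=
    hper.tendsto_atBot_intervalIntegral_of_pos' hint hpos hT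
  obtain ⟨C, hC⟩ := (hper.isBounded_of_continuous hT.ne'
    (continuous_inv_weight hψc)).exists_norm_le
  have hlim : ∀ {l : Filter ℝ} {v : ℝ},
      Tendsto (fun t => 1 - v * invWeightPrimitive ψ t) l atTop →
      Tendsto (fun t => shiftedSolution ψ v t - ψ t) l (𝓝 0) := by
    intro l v h
    have h1 : Tendsto (fun t => v / (1 - v * invWeightPrimitive ψ t)) l (𝓝 0) :=
      h.const_div_atTop v
    have h2 := h1.zero_mul_isBoundedUnder_le (g := fun s => (weight ψ s)⁻¹)
      (isBoundedUnder_of ⟨C, fun t => hC _ (mem_range_self t)⟩)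
    refine h2.congr fun t => ?_
    rw [shiftedSolution, add_sub_cancel_left, div_mul_eq_div_div_swap, div_eq_mul_inv _ (weight ψ t)]
  -- The radius `1` is arbitrary: the argument uses only the sign of `x - ψ 0`.
  refine ⟨1, one_pos, Or.inl ⟨fun x hx => ?_, fun x hx => ?_⟩⟩
  · have hv : x - ψ 0 < 0 := sub_neg.2 hx.2
    refine ⟨shiftedSolution ψ (x - ψ 0), by rw [shiftedSolution_zero, add_sub_cancel],
      isSolutionOn_shiftedSolution hψ.2 fun t ht => ?_, hlim ?_⟩
    · have := hmono (mem_Ici.1 ht)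
      rw [invWeightPrimitive_zero] at this
      nlinarith
    · exact (tendsto_atTop_add_const_left atTop 1 (htop.const_mul_atTop (neg_pos.2 hv))).congr
        fun t => by ring
  · have hv : 0 < x - ψ 0 := sub_pos.2 hx.1
    refine ⟨shiftedSolution ψ (x - ψ 0), by rw [shiftedSolution_zero, add_sub_cancel],
      isSolutionOn_shiftedSolution hψ.2 fun t ht => ?_, hlim ?_⟩
    · have := hmono (mem_Iic.1 ht)
      rw [invWeightPrimitive_zero] at this
      nlinarith
    · simpa [sub_eq_add_neg] using
        tendsto_atTop_add_const_left atBot 1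
          (tendsto_neg_atBot_atTop.comp (hbot.const_mul_atBot hv))

/-! ### Counting limit cycles -/

/-- A periodic solution with nonzero average comes with exactly one other periodic solution. -/
theorem exists_other_isPeriodicSolution {γ ψ : ℝ → ℝ} {T : ℝ} (hT : 0 < T) (hγ : Continuous γ)
    (hper : Function.Periodic γ T) (hψ : IsPeriodicSolution (riccati γ) T ψ)
    (hm : mean T ψ ≠ 0) :
    ∃ φ, ψ ≠ φ ∧ {x | IsPeriodicSolution (riccati γ) T x} = {ψ, φ} := by
  have hψc := hψ.2.continuous
  have hW1 : weight ψ T ≠ 1 := mt (weight_eq_one_iff hT).1 hm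
  have hW := weight_pos ψ T
  have hB := invWeightPrimitive_pos hψc hT
  -- This is the second fixed point of the period map. It satisfies `v * invWeightPrimitive ψ T <
  -- 1`, so its solution survives the whole period.
  set v : ℝ := (1 - (weight ψ T)⁻¹) / invWeightPrimitive ψ T with hv
  have hvB : v * invWeightPrimitive ψ T = 1 - (weight ψ T)⁻¹ := by rw [hv]; field_simp
  have hv0 : v ≠ 0 := by
    rintro h
    rw [h, zero_mul] at hvB
    exact hW1 (inv_eq_one.1 (by linarith))
  obtain ⟨φ, hφ, hφ0⟩ := exists_isPeriodicSolution_of_eq hT (continuous_riccati hγ)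
    (riccati_add_period hper) (x := shiftedSolution ψ v)
    (isSolutionOn_shiftedSolution hψ.2 fun t ht =>
      (one_sub_mul_invWeightPrimitive_pos hψc (by
        rw [hvB]
        linarith [inv_pos.2 hW]) ht).ne')
    (by
      rw [shiftedSolution_zero, shiftedSolution, apply_period hψ.1, hvB, sub_sub_cancel,
        mul_inv_cancel₀ hW.ne', div_one])
  rw [shiftedSolution_zero] at hφ0
  refine ⟨φ, fun h => hv0 ?_, Set.ext fun x => ⟨fun hx => ?_, ?_⟩⟩
  · rw [← h] at hφ0
    linarith
  · rcases hψ.apply_zero_eq hT hx with h | h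
    · exact Or.inl (hψ.eq_of_apply_zero hT hx h)
    · refine Or.inr (hφ.eq_of_apply_zero hT hx ?_)
      have : (x 0 - ψ 0) * invWeightPrimitive ψ T = v * invWeightPrimitive ψ T := by
        rw [hvB, ← eq_inv_of_mul_eq_one_right h]
        ring
      rw [hφ0, ← mul_right_cancel₀ hB.ne' this]
      ring
  · rintro (rfl | rfl)
    exacts [hψ, hφ]

theorem isPeriodicSolution_unique_of_mean_eq_zero {γ ψ φ : ℝ → ℝ} {T : ℝ} (hT : 0 < T)
    (hψ : IsPeriodicSolution (riccati γ) T ψ) (hm : mean T ψ = 0)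
    (hφ : IsPeriodicSolution (riccati γ) T φ) : φ = ψ := by
  refine hψ.eq_of_apply_zero hT hφ ?_
  rcases hψ.apply_zero_eq hT hφ with h | h
  · exact h
  · rw [(weight_eq_one_iff hT).2 hm, one_mul, sub_eq_self, mul_eq_zero] at h
    exact sub_eq_zero.1 (h.resolve_right (invWeightPrimitive_pos hψ.2.continuous hT).ne')

/-- If there are finitely many periodic solutions, all of them are limit cycles. -/
theorem setOf_isLimitCycle_eq {γ : ℝ → ℝ} {T : ℝ} (hT : 0 < T)
    (hfin : {x | IsPeriodicSolution (riccati γ) T x}.Finite) :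
    {x | IsLimitCycle (riccati γ) T x} = {x | IsPeriodicSolution (riccati γ) T x} := by
  refine Set.ext fun φ => ⟨fun h => h.1, fun hφ => ⟨hφ, ?_⟩⟩
  have hc : IsClosed ((fun x : ℝ → ℝ => x 0) ''
      ({x | IsPeriodicSolution (riccati γ) T x} \ {φ})) :=
    ((hfin.subset sdiff_subset).image _).isClosed
  have hmem : φ 0 ∉ (fun x : ℝ → ℝ => x 0) ''
      ({x | IsPeriodicSolution (riccati γ) T x} \ {φ}) := by
    rintro ⟨x, ⟨hx, hne⟩, h0⟩
    exact hne (IsPeriodicSolution.eq_of_apply_zero hT hφ hx h0)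
  obtain ⟨ε, hε, hball⟩ := Metric.isOpen_iff.1 hc.isOpen_compl _ hmem
  refine ⟨ε, hε, fun x hx hd => ?_⟩
  by_contra hne
  exact hball (Metric.mem_ball.2 hd) ⟨x, ⟨hx, hne⟩, rfl⟩

end RiccatiEq

/-! ### The trichotomy by the sign of the discriminant -/

open RiccatiEq in
theorem mainTheorem2 (T : ℝ) (hT : 0 < T) (γ : ℝ → ℝ) (hγ : γ ∈ C1T T) :
    -- the maximum and the minimum that define `γ*` exist and coincide
    (IsGreatest (muLower T γ '' C1T T) (gammaStar T γ) ∧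
      IsLeast (muUpper T γ '' C1T0 T) (gammaStar T γ)) ∧
    (0 < discriminant T γ →
      ∃ φ₁ φ₂ : ℝ → ℝ, φ₁ ≠ φ₂ ∧
        {φ | IsLimitCycle (riccati γ) T φ} = {φ₁, φ₂} ∧
        IsHyperbolic (riccati γ) T φ₁ ∧ IsHyperbolic (riccati γ) T φ₂) ∧
    (discriminant T γ = 0 →
      ∃ φ : ℝ → ℝ, {ψ | IsLimitCycle (riccati γ) T ψ} = {φ} ∧
        IsSemistable (riccati γ) φ ∧ IsDouble (riccati γ) T φ) ∧
    (discriminant T γ < 0 → ¬ ∃ φ : ℝ → ℝ, IsLimitCycle (riccati γ) T φ) ∧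
    (∀ p ∈ C1T T, ∀ q ∈ C1T0 T,
      muLower T γ p - mean T γ ≤ discriminant T γ ∧
        discriminant T γ ≤ muUpper T γ q - mean T γ) := by
  have hγc : Continuous γ := hγ.1.continuous
  obtain ⟨hgr, hle, φ, hφ, hm⟩ := exists_extremal hT hγc hγ.2
  have hcen : ∀ {x}, IsPeriodicSolution (riccati γ) T x →
      IsPeriodicSolution (riccati fun t => centered T γ t + mean T γ) T x := fun h => by
    rwa [centered_add_mean]
  refine ⟨⟨hgr, hle⟩, fun hΔ => ?_, fun hΔ => ?_, fun hΔ => ?_, fun p hp q hq => ⟨?_, ?_⟩⟩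
  · have hlt : mean T γ < gammaStar T γ := sub_pos.1 hΔ
    -- The critical solution `φ`, belonging to the larger constant `gammaStar T γ`, is a strict
    -- upper solution for `γ`.
    obtain ⟨ψ, hψ⟩ := exists_isPeriodicSolution_of_upper hT hγc hγ.2 hφ.2.hasDerivAt
      (apply_period hφ.1) (fun t _ => by simp only [riccati, centered]; linarith)
    -- A periodic solution of zero average would give `muUpper` the value `mean T γ`, below its
    -- minimum.
    have hne : ∀ {x}, IsPeriodicSolution (riccati γ) T x → mean T x ≠ 0 := fun {x} hx h0 => by
      have h1 := hle.2 ⟨x, ⟨hx.mem_C1T hγc, h0⟩, rfl⟩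
      rw [muUpper_of_isPeriodicSolution hT hγc (hcen hx) h0] at h1
      exact h1.not_gt hlt
    obtain ⟨χ, hψχ, hset⟩ := exists_other_isPeriodicSolution hT hγc hγ.2 hψ (hne hψ)
    have hχ : IsPeriodicSolution (riccati γ) T χ := by
      have : χ ∈ {x | IsPeriodicSolution (riccati γ) T x} := by rw [hset]; simp
      exact this
    refine ⟨ψ, χ, hψχ, ?_, hψ.isHyperbolic hT (hne hψ), hχ.isHyperbolic hT (hne hχ)⟩
    rw [setOf_isLimitCycle_eq hT (by rw [hset]; exact Set.toFinite _), hset]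
  · rw [sub_eq_zero.1 hΔ, centered_add_mean] at hφ
    have hset : {x | IsPeriodicSolution (riccati γ) T x} = {φ} := Set.ext fun x =>
      ⟨fun hx => isPeriodicSolution_unique_of_mean_eq_zero hT hφ hm hx, by rintro rfl; exact hφ⟩
    refine ⟨φ, ?_, hφ.isSemistable hT hm, hφ.isDouble hT hm⟩
    rw [setOf_isLimitCycle_eq hT (by rw [hset]; exact Set.toFinite _), hset]
  · rintro ⟨x, hx, -⟩
    -- Any periodic solution gives `muLower` the value `mean T γ`, here above its maximum.
    have h := hgr.2 ⟨x, hx.mem_C1T hγc, rfl⟩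
    rw [muLower_of_isPeriodicSolution hT (hcen hx)] at h
    exact h.not_gt (sub_neg.1 hΔ)
  · exact sub_le_sub_right (hgr.2 ⟨p, hp, rfl⟩) _
  · exact sub_le_sub_right (hle.2 ⟨q, hq, rfl⟩) _
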